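/- Let $V$ be a super vertex operator algebra (SVOA) over $\mathbb{C}$ of central charge $\mathbf{c}$ with Virasoro grading $V=\bigoplus_{n\in\frac12\mathbb{Z}}V_n$ by the eigenvalues of $L(0)$, where $\dim V_n<\infty$ and $V_n=0$ for $n\ll 0$, and with parity $|v|=2\,\mathrm{wt}(v)\bmod 2$. Write $\sigma$ for the parity involution, $\sigma v=(-1)^{|v|}v$. A *root* of level $m\in\mathbb{C}$ is a vector $h\in V_1$ with $h(1)h=2m\mathbf{1}$ such that $h(0)$ acts semisimply on $V$ with integer eigenvalues; $h$ is a *parity root* if moreover $\sigma=e^{i\pi h(0)}$. For a root $h$ put $$h_\sigma(0)=h(0)+m,\qquad L_\sigma(0)=L(0)+\tfrac12h(0)+\tfrac14 m,$$ the zero modes of the Ramond sector $Y_\sigma(v,z)=Y(\Delta(\sigma,z)v,z)$, $\Delta(\sigma,z)=z^{\frac12h(0)}\exp\bigl(-\tfrac12\sum_{n\ge1}\tfrac{h(n)}{n}(-z)^{-n}\bigr)$, and let $$\mathcal{E}_{V,h}(z;\tau)=\operatorname{str}_V\bigl(\zeta^{h_\sigma(0)}q^{L_\sigma(0)-\mathbf{c}/24}\bigr),\qquad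 \zeta=e^{2\pi iz},\ q=e^{2\pi i\tau},$$ be the elliptic genus (Ramond supertrace). Let $$2\phi_{0,1}(z;\tau)=8\left(\frac{\theta_2(z;\tau)^2}{\theta_2(0;\tau)^2}+\frac{\theta_3(z;\tau)^2}{\theta_3(0;\tau)^2}+\frac{\theta_4(z;\tau)^2}{\theta_4(0;\tau)^2}\right)$$ be the elliptic genus of a $K3$ surface, where $\theta_2,\theta_3,\theta_4$ are the Jacobi theta series $\sum_{n\in\mathbb{Z}}e^{2\pi i(n+a)b}q^{\frac12(n+a)^2}\zeta^{n+a}$ with $(a,b)=(\tfrac12,0),(0,0),(0,\tfrac12)$ respectively. **Proposition.** If $h$ is a root of $V$ for which $\mathcal{E}_{V,h}$ converges absolutely on $\mathbb{C}\times\mathbb{H}$ and $\mathcal{E}_{V,h}=2\phi_{0,1}$ or $\mathcal{E}_{V,h}=-2\phi_{0,1}$, then $h$ is not a parity root. **Corollary.** The elliptic genus $2\phi_{0,1}$ of a $K3$ surface is not the elliptic genus of any SVOA with a parity root. -/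

import Mathlib

universe u

noncomputable section

/-! ## Super vertex operator algebras -/

/-- A super vertex operator algebra (SVOA) structure on a complex vector space `V`, with
`½ℤ`-graded Virasoro weights.  `Y u = ∑ₙ u(n) z⁻ⁿ⁻¹` is the state-field map.  The weight space of
weight `k / 2`, for an integer `k`, is the `k / 2`-eigenspace of `L(0) = ω(1)`, and the parity of
its vectors is `k mod 2`. -/
structure SVOA (V : Type u) [AddCommGroup V] [Module ℂ V] where
  /-- the state-field map -/
  Y : V →ₗ[ℂ] VertexOperator ℂ V
  /-- the vacuum vector -/
  vac : V
  /-- the Virasoro vector -/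
  ω : V
  /-- the central charge -/
  c : ℂ
  vacuum_mode : ∀ n : ℤ, VertexOperator.ncoeff (Y vac) n = if n = -1 then 1 else 0
  creation_nonneg : ∀ (u : V) (n : ℤ), 0 ≤ n → VertexOperator.ncoeff (Y u) n vac = 0
  creation : ∀ u : V, VertexOperator.ncoeff (Y u) (-1) vac = u
  /-- `V` is the direct sum of its weight spaces of half-integral weights -/
  grading : DirectSum.IsInternal fun k : ℤ =>
    (VertexOperator.ncoeff (Y ω) 1).eigenspace ((k : ℂ) / 2)
  finite_weightSpace : ∀ k : ℤ,
    FiniteDimensional ℂ ((VertexOperator.ncoeff (Y ω) 1).eigenspace ((k : ℂ) / 2))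
  weight_bddBelow : ∃ K : ℤ, ∀ k : ℤ, k < K →
    (VertexOperator.ncoeff (Y ω) 1).eigenspace ((k : ℂ) / 2) = ⊥
  /-- the Borcherds (super Jacobi) identity -/
  borcherds : ∀ (j k : ℤ) (u v w : V) (p q r : ℤ),
    u ∈ (VertexOperator.ncoeff (Y ω) 1).eigenspace ((j : ℂ) / 2) →
    v ∈ (VertexOperator.ncoeff (Y ω) 1).eigenspace ((k : ℂ) / 2) →
    ∑ᶠ i : ℕ, Ring.choose p i • VertexOperator.ncoeff
        (Y (VertexOperator.ncoeff (Y u) (r + i) v)) (p + q - i) w =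
      ∑ᶠ i : ℕ, ((-1) ^ i * Ring.choose r i) •
        (VertexOperator.ncoeff (Y u) (p + r - i) (VertexOperator.ncoeff (Y v) (q + i) w) -
          ((-1 : ℂ) ^ (j * k) * (-1 : ℂ) ^ r) •
            VertexOperator.ncoeff (Y v) (q + r - i) (VertexOperator.ncoeff (Y u) (p + i) w))
  /-- the Virasoro relations for `L(n) = ω(n + 1)` -/
  virasoro : ∀ m n : ℤ,
    VertexOperator.ncoeff (Y ω) (m + 1) * VertexOperator.ncoeff (Y ω) (n + 1) -
      VertexOperator.ncoeff (Y ω) (n + 1) * VertexOperator.ncoeff (Y ω) (m + 1) =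
    ((m : ℂ) - n) • VertexOperator.ncoeff (Y ω) (m + n + 1) +
      (if m + n = 0 then ((m : ℂ) ^ 3 - m) / 12 * c else 0) • (1 : Module.End ℂ V)
  /-- `Y(L(-1)u, z) = d/dz Y(u, z)` -/
  translation : ∀ (u : V) (n : ℤ),
    VertexOperator.ncoeff (Y (VertexOperator.ncoeff (Y ω) 0 u)) n =
      -(n : ℂ) • VertexOperator.ncoeff (Y u) (n - 1)

/-- For a direct sum decomposition `M = ⨁ₖ W k` and scalars `f k`, the operator on `M` that acts on
each `W k` as multiplication by `f k`. -/
def scalarOnPieces {M : Type u} [AddCommGroup M] [Module ℂ M] (W : ℤ → Submodule ℂ M)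
    (hW : DirectSum.IsInternal W) (f : ℤ → ℂ) : Module.End ℂ M :=
  (DirectSum.toModule ℂ ℤ M fun k => f k • (W k).subtype) ∘ₗ
    ((LinearEquiv.ofBijective (DirectSum.coeLinearMap W) hW).symm : M →ₗ[ℂ] _)

theorem scalarOnPieces_apply {M : Type u} [AddCommGroup M] [Module ℂ M] (W : ℤ → Submodule ℂ M)
    (hW : DirectSum.IsInternal W) (f : ℤ → ℂ) (k : ℤ) (v : M) (hv : v ∈ W k) :
    scalarOnPieces W hW f v = f k • v := by
  have h : (LinearEquiv.ofBijective (DirectSum.coeLinearMap W) hW).symm v =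
      DirectSum.lof ℂ ℤ (fun k => W k) k ⟨v, hv⟩ := by
    rw [LinearEquiv.symm_apply_eq]
    exact (DirectSum.coeLinearMap_lof W k ⟨v, hv⟩).symm
  rw [scalarOnPieces, LinearMap.comp_apply]
  erw [h]
  rw [DirectSum.toModule_lof]
  simp

namespace SVOA

variable {V : Type u} [AddCommGroup V] [Module ℂ V] (S : SVOA V)

/-- The mode `u(n)`, the coefficient of `z⁻ⁿ⁻¹` in `Y(u, z)`. -/
def mode (u : V) (n : ℤ) : Module.End ℂ V := VertexOperator.ncoeff (S.Y u) n

/-- The Virasoro operator `L(n) = ω(n + 1)`. -/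
def L (n : ℤ) : Module.End ℂ V := S.mode S.ω (n + 1)

/-- The space `V_{k/2}` of vectors of Virasoro weight `k / 2`. -/
def weightSpace (k : ℤ) : Submodule ℂ V := (S.L 0).eigenspace ((k : ℂ) / 2)

/-- The even part of `V`, spanned by the vectors of integral weight. -/
def evenPart : Submodule ℂ V := ⨆ k : ℤ, S.weightSpace (2 * k)

/-- The odd part of `V`, spanned by the vectors of weight in `ℤ + 1/2`. -/
def oddPart : Submodule ℂ V := ⨆ k : ℤ, S.weightSpace (2 * k + 1)

theorem isInternal_weightSpace : DirectSum.IsInternal S.weightSpace := S.grading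

/-- The parity involution `σ`, acting as `(-1)^{2 wt(v)}` on a vector `v` of weight `wt(v)`. -/
def parityInvolution : Module.End ℂ V :=
  scalarOnPieces S.weightSpace S.isInternal_weightSpace fun k => (-1 : ℂ) ^ k

/-! ## Roots and parity roots -/

/-- `h` is a root of level (index) `m`: it has weight `1`, `h(1)h = 2m·1`, and `h(0)` acts
semisimply on `V` with integer eigenvalues. -/
structure IsRoot (h : V) (m : ℂ) : Prop where
  weight_one : h ∈ S.weightSpace 2
  level : S.mode h 1 h = (2 * m) • S.vac
  semisimple : DirectSum.IsInternal fun r : ℤ => (S.mode h 0).eigenspace (r : ℂ)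

variable {S} in
/-- The operator `e^{iπh(0)}` of a root `h`. -/
def IsRoot.expPiI {h : V} {m : ℂ} (hr : S.IsRoot h m) : Module.End ℂ V :=
  scalarOnPieces (fun r : ℤ => (S.mode h 0).eigenspace (r : ℂ)) hr.semisimple
    fun r => Complex.exp (Real.pi * Complex.I * r)

variable {S} in
/-- The root `h` is a parity root: `σ = e^{iπh(0)}`. -/
def IsRoot.IsParityRoot {h : V} {m : ℂ} (hr : S.IsRoot h m) : Prop :=
  S.parityInvolution = hr.expPiI

/-! ## The Ramond sector

With `Δ(σ, z) = z^{h(0)/2} exp(-½ ∑_{n ≥ 1} h(n)/n (-z)⁻ⁿ)`, the Ramond sector is the space `V` with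
the fields `Y_σ(v, z) = Y(Δ(σ, z)v, z)`. -/

/-- The exponent `-½ ∑_{n ≥ 1} (-1)ⁿ h(n)/n xⁿ`, where `x = z⁻¹`. -/
def deltaExponent (h : V) : PowerSeries (Module.End ℂ V) :=
  PowerSeries.mk fun n => if n = 0 then 0 else (-(1 / 2) * (-1 : ℂ) ^ n / n) • S.mode h n

/-- The coefficient of `z⁻ᵏ` in the exponential of the exponent.  The exponent has no constant
term, so only the powers up to the `k`-th contribute. -/
def deltaCoeff (h : V) (k : ℕ) : Module.End ℂ V :=
  ∑ j ∈ Finset.range (k + 1),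
    (1 / (j.factorial : ℂ)) • PowerSeries.coeff k (S.deltaExponent h ^ j)

/-- If `h(0)v = r v`, this is the coefficient of `z^{r/2 - n - 1}` in
`Y_σ(v, z) = Y(Δ(σ, z)v, z)`. -/
def twistedMode (h v : V) (n : ℤ) : Module.End ℂ V :=
  ∑ᶠ k : ℕ, S.mode (S.deltaCoeff h k v) (n - k)

/-- The zero mode `h_σ(0) = h(0) + m` of `h` in the Ramond sector. -/
def ramondCharge (h : V) (m : ℂ) : Module.End ℂ V := S.mode h 0 + m • 1

/-- The zero mode `L_σ(0) = L(0) + ½ h(0) + ¼ m` of the Virasoro field in the Ramond sector. -/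
def ramondEnergy (h : V) (m : ℂ) : Module.End ℂ V :=
  S.L 0 + (1 / 2 : ℂ) • S.mode h 0 + (m / 4) • 1

theorem commutator_neg_one (u w : V) (n j k : ℤ)
    (hu : u ∈ S.weightSpace j) (hw : w ∈ S.weightSpace k) (hjk : Even (j * k)) (x : V)
    (h2 : ∀ i : ℕ, 2 ≤ i → S.mode w i u = 0) :
    S.mode w (-1) (S.mode u n x) - S.mode u n (S.mode w (-1) x) =
      S.mode (S.mode w 0 u) (n - 1) x - S.mode (S.mode w 1 u) (n - 2) x := by
  have hb := S.borcherds k j w u x (-1) n 0 hw hu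
  have hs : (-1 : ℂ) ^ (k * j) = 1 := by rw [mul_comm]; exact hjk.neg_one_zpow
  rw [finsum_eq_sum_of_support_subset (s := Finset.range 2),
    finsum_eq_sum_of_support_subset (s := Finset.range 1)] at hb
  · simp [Finset.sum_range_succ, hs] at hb
    have e1 : (-1 : ℤ) + n = n - 1 := by ring
    have e2 : (-1 : ℤ) + n - 1 = n - 2 := by ring
    rw [e1, show n - 1 - 1 = n - 2 by ring] at hb
    simp only [mode]
    rw [← hb]
    abel
  · intro i hi
    by_contra hi'
    have : 1 ≤ i := by simp at hi'; omega
    apply hi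
    simp [Ring.choose_zero_pos ℤ this]
  · intro i hi
    by_contra hi'
    have : 2 ≤ i := by simp at hi'; omega
    apply hi
    have := h2 i this
    simp only [mode] at this
    simp [this]

theorem mode_vac_of_ne (n : ℤ) (hn : n ≠ -1) (x : V) : S.mode S.vac n x = 0 := by
  simp [mode, S.vacuum_mode, hn]

theorem mode_vac_neg_one (x : V) : S.mode S.vac (-1) x = x := by
  simp [mode, S.vacuum_mode]

theorem mode_create (u : V) : S.mode u (-1) S.vac = u := S.creation u

theorem mode_vac_zero (u : V) (n : ℤ) (hn : 0 ≤ n) : S.mode u n S.vac = 0 :=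
  S.creation_nonneg u n hn

theorem mode_smul (a : ℂ) (u x : V) (n : ℤ) : S.mode (a • u) n x = a • S.mode u n x := by
  simp [mode]

theorem mode_zero (n : ℤ) (x : V) : S.mode 0 n x = 0 := by
  simp [mode]

theorem omega_mem_weightSpace : S.ω ∈ S.weightSpace 4 := by
  have h := congrArg (fun T : Module.End ℂ V => T S.vac) (S.virasoro 0 (-2))
  have h1 := S.creation S.ω
  have h2 := S.creation_nonneg S.ω 1 (by norm_num)
  norm_num [h1, h2] at h
  rw [weightSpace, Module.End.mem_eigenspace_iff]
  simp only [L, mode]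
  norm_num [h]

/-- For a root `h`, one has `h(0)h = 0`, provided that `h(n)h = 0` for `n ≥ 2`. -/
theorem IsRoot.mode_zero_self {h : V} {m : ℂ} (hr : S.IsRoot h m)
    (hh : ∀ i : ℕ, 2 ≤ i → S.mode h i h = 0) : S.mode h 0 h = 0 := by
  have := S.commutator_neg_one h h 0 2 2 hr.weight_one hr.weight_one (by decide) S.vac hh
  rw [hr.level, S.mode_smul, S.mode_vac_of_ne _ (by norm_num), mode_create,
    S.mode_vac_zero h 0 le_rfl] at this
  norm_num [mode_create] at this
  have h2 : (2 : ℂ) • S.mode h 0 h = 0 := by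
    rw [two_smul]
    nth_rewrite 1 [← this]
    simp
  simpa using h2

/-- The action of the modes of a primary vector of weight one on the Virasoro vector. -/
theorem mode_omega {h : V} (hw : h ∈ S.weightSpace 2)
    (hp : ∀ i : ℕ, 1 ≤ i → S.L i h = 0) (n : ℕ) :
    S.mode h n S.ω = if n = 1 then h else 0 := by
  have h2 : ∀ i : ℕ, 2 ≤ i → S.mode S.ω i h = 0 := by
    intro i hi
    have := hp (i - 1) (by omega)
    simp only [L] at this
    rwa [show (((i - 1 : ℕ) : ℤ) + 1) = i by omega] at this
  have := S.commutator_neg_one h S.ω n 2 4 hw S.omega_mem_weightSpace (by decide) S.vac h2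
  have hw' : S.mode S.ω 1 h = h := by
    have hw2 := hw
    rw [weightSpace, Module.End.mem_eigenspace_iff] at hw2
    simpa [L] using hw2
  have ht : S.mode (S.mode S.ω 0 h) ((n : ℤ) - 1) S.vac =
      -((n : ℂ) - 1) • S.mode h ((n : ℤ) - 2) S.vac := by
    have := congrArg (fun T : Module.End ℂ V => T S.vac) (S.translation h ((n : ℤ) - 1))
    simp only [mode]
    rw [this, show (n : ℤ) - 1 - 1 = n - 2 by ring]
    simp
  rw [hw', ht, mode_create, S.mode_vac_zero h n (by omega), map_zero, zero_sub] at this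
  have key : S.mode h n S.ω = (n : ℂ) • S.mode h ((n : ℤ) - 2) S.vac := by
    rw [← neg_inj, this]
    module
  rw [key]
  rcases n with _ | _ | n
  · simp
  · norm_num [mode_create]
  · rw [S.mode_vac_zero h _ (by push_cast; omega)]
    simp

theorem coeff_deltaExponent_pow_zero (h x : V) (k : ℕ) :
    (PowerSeries.coeff k (S.deltaExponent h ^ 0) : Module.End ℂ V) x = if k = 0 then x else 0 := by
  rw [pow_zero, PowerSeries.coeff_one]
  split_ifs <;> simp

theorem coeff_deltaExponent_pow_succ (h x y : V)
    (hx : ∀ n : ℕ, 1 ≤ n → S.mode h n x = if n = 1 then (2 : ℂ) • y else 0) (j k : ℕ) :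
    PowerSeries.coeff k (S.deltaExponent h ^ (j + 1)) x =
      if k = 0 then 0 else PowerSeries.coeff (k - 1) (S.deltaExponent h ^ j) y := by
  have hA : ∀ n : ℕ, PowerSeries.coeff n (S.deltaExponent h) x = if n = 1 then y else 0 := by
    intro n
    rw [deltaExponent, PowerSeries.coeff_mk]
    rcases n with _ | _ | n
    · simp
    · have := hx 1 le_rfl
      simp only [Nat.cast_one, if_true] at this
      simp [this, smul_smul]
    · have := hx (n + 2) (by omega)
      simp at this
      simp [this, add_assoc]
  rw [pow_succ, PowerSeries.coeff_mul, LinearMap.sum_apply]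
  rcases k with _ | k
  · simp [hA]
  · rw [Finset.sum_eq_single (k, 1)]
    · simp [hA]
    · rintro ⟨a, b⟩ hab hne
      have : b ≠ 1 := by
        rintro rfl
        apply hne
        simp at hab
        simp [hab]
      simp [hA, this]
    · simp

theorem coeff_deltaExponent_pow_vac (h : V) (j k : ℕ) :
    PowerSeries.coeff k (S.deltaExponent h ^ j) S.vac = if j = 0 ∧ k = 0 then S.vac else 0 := by
  rcases j with _ | j
  · rw [coeff_deltaExponent_pow_zero]
    simp
  · rw [S.coeff_deltaExponent_pow_succ h S.vac 0]
    · simp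
    · intro n _
      rw [S.mode_vac_zero h n (by omega)]
      simp

theorem coeff_deltaExponent_pow_root {h : V} {m : ℂ} (hr : S.IsRoot h m)
    (hh : ∀ i : ℕ, 2 ≤ i → S.mode h i h = 0) (j k : ℕ) :
    PowerSeries.coeff k (S.deltaExponent h ^ j) h =
      if j = 0 ∧ k = 0 then h else if j = 1 ∧ k = 1 then m • S.vac else 0 := by
  rcases j with _ | j
  · rw [coeff_deltaExponent_pow_zero]
    simp
  · rw [S.coeff_deltaExponent_pow_succ h h (m • S.vac)]
    · rcases k with _ | k
      · simp
      · simp [coeff_deltaExponent_pow_vac]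
    · intro n hn
      rcases n with _ | _ | n
      · omega
      · simp [hr.level, smul_smul]
      · rw [hh _ (by omega)]
        simp

theorem coeff_deltaExponent_pow_omega {h : V} {m : ℂ} (hr : S.IsRoot h m)
    (hh : ∀ i : ℕ, 2 ≤ i → S.mode h i h = 0) (hp : ∀ i : ℕ, 1 ≤ i → S.L i h = 0) (j k : ℕ) :
    PowerSeries.coeff k (S.deltaExponent h ^ j) S.ω =
      if j = 0 ∧ k = 0 then S.ω else if j = 1 ∧ k = 1 then (1 / 2 : ℂ) • h else
        if j = 2 ∧ k = 2 then (m / 2) • S.vac else 0 := by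
  rcases j with _ | j
  · rw [coeff_deltaExponent_pow_zero]
    simp
  · rw [S.coeff_deltaExponent_pow_succ h S.ω ((1 / 2 : ℂ) • h)]
    · rcases k with _ | k
      · simp
      · simp only [Nat.add_eq_zero_iff, one_ne_zero, and_false, if_false, Nat.add_sub_cancel,
          map_smul, S.coeff_deltaExponent_pow_root hr hh]
        rcases j with _ | _ | j <;> rcases k with _ | _ | k <;> simp [smul_smul]
        congr 1
        ring
    · intro n hn
      rw [S.mode_omega hr.weight_one hp]
      simp [smul_smul]

theorem deltaCoeff_root {h : V} {m : ℂ} (hr : S.IsRoot h m)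
    (hh : ∀ i : ℕ, 2 ≤ i → S.mode h i h = 0) (k : ℕ) :
    S.deltaCoeff h k h = if k = 0 then h else if k = 1 then m • S.vac else 0 := by
  simp only [deltaCoeff, LinearMap.sum_apply, LinearMap.smul_apply,
    S.coeff_deltaExponent_pow_root hr hh]
  rcases k with _ | _ | k <;> simp

theorem deltaCoeff_omega {h : V} {m : ℂ} (hr : S.IsRoot h m)
    (hh : ∀ i : ℕ, 2 ≤ i → S.mode h i h = 0) (hp : ∀ i : ℕ, 1 ≤ i → S.L i h = 0) (k : ℕ) :
    S.deltaCoeff h k S.ω = if k = 0 then S.ω else if k = 1 then (1 / 2 : ℂ) • h else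
      if k = 2 then (m / 4) • S.vac else 0 := by
  simp only [deltaCoeff, LinearMap.sum_apply, LinearMap.smul_apply,
    S.coeff_deltaExponent_pow_omega hr hh hp]
  rcases k with _ | _ | _ | k <;> simp [smul_smul]
  congr 1
  ring

/-- The Ramond sector operators `h_σ(0)` and `L_σ(0)` are the zero modes of the twisted fields
`Y_σ(h, z)` and `Y_σ(ω, z)` whenever `h` is a primary vector that generates a Heisenberg algebra
(in this case `h` and `ω` are annihilated by `h(0)`). -/
theorem twistedMode_eq {h : V} {m : ℂ} (hr : S.IsRoot h m)
    (hh : ∀ i : ℕ, 2 ≤ i → S.mode h i h = 0) (hp : ∀ i : ℕ, 1 ≤ i → S.L i h = 0) :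
    S.mode h 0 h = 0 ∧ S.mode h 0 S.ω = 0 ∧
      S.twistedMode h h 0 = S.ramondCharge h m ∧
      S.twistedMode h S.ω 1 = S.ramondEnergy h m := by
  refine ⟨IsRoot.mode_zero_self S hr hh, ?_, ?_, ?_⟩
  · simpa using S.mode_omega hr.weight_one hp 0
  · rw [twistedMode, finsum_eq_sum_of_support_subset (s := Finset.range 2)]
    · ext x
      simp [Finset.sum_range_succ, S.deltaCoeff_root hr hh, ramondCharge, mode_smul,
        mode_vac_neg_one]
    · intro k hk
      by_contra hk'
      have : 2 ≤ k := by simp at hk'; omega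
      apply hk
      ext x
      beta_reduce
      rw [S.deltaCoeff_root hr hh, if_neg (by omega), if_neg (by omega)]
      simp [mode_zero]
  · rw [twistedMode, finsum_eq_sum_of_support_subset (s := Finset.range 3)]
    · ext x
      simp [Finset.sum_range_succ, S.deltaCoeff_omega hr hh hp, ramondEnergy, mode_smul, L,
        mode_vac_neg_one]
    · intro k hk
      by_contra hk'
      have : 3 ≤ k := by simp at hk'; omega
      apply hk
      ext x
      beta_reduce
      rw [S.deltaCoeff_omega hr hh hp, if_neg (by omega), if_neg (by omega), if_neg (by omega)]
      simp [mode_zero]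

/-! ## The elliptic genus -/

/-- The superdimension of the simultaneous eigenspace of `h_σ(0)` and `L_σ(0)` for the eigenvalues
`a` and `b`. -/
def ramondSuperdim (h : V) (m a b : ℂ) : ℂ :=
  (Module.finrank ℂ
    ↥(S.evenPart ⊓ (S.ramondCharge h m).eigenspace a ⊓ (S.ramondEnergy h m).eigenspace b) : ℂ) -
  (Module.finrank ℂ
    ↥(S.oddPart ⊓ (S.ramondCharge h m).eigenspace a ⊓ (S.ramondEnergy h m).eigenspace b) : ℂ)

/-- The elliptic genus, that is the Ramond supertrace `str_V(ζ^{h_σ(0)} q^{L_σ(0) - c/24})` with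
`ζ = e^{2πiz}` and `q = e^{2πiτ}`, converges (absolutely) on `ℂ × ℍ` and equals `φ`. -/
def HasEllipticGenus (h : V) (m : ℂ) (φ : ℂ → UpperHalfPlane → ℂ) : Prop :=
  ∀ (z : ℂ) (τ : UpperHalfPlane), HasSum
    (fun p : ℂ × ℂ => S.ramondSuperdim h m p.1 p.2 *
      Complex.exp (2 * Real.pi * Complex.I * z * p.1) *
      Complex.exp (2 * Real.pi * Complex.I * τ * (p.2 - S.c / 24)))
    (φ z τ)

end SVOA

/-! ## Theta functions and the K3 elliptic genus -/

/-- The theta series with characteristic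
`ϑ[a, b](z; τ) = ∑ₙ e^{2πi(n + a)b} q^{(n + a)²/2} ζ^{n + a}`. -/
def thetaChar (a b : ℝ) (z : ℂ) (τ : UpperHalfPlane) : ℂ :=
  ∑' n : ℤ, Complex.exp (2 * Real.pi * Complex.I * (n + a) * b) *
    Complex.exp (2 * Real.pi * Complex.I * τ * ((n + a) ^ 2 / 2)) *
    Complex.exp (2 * Real.pi * Complex.I * z * (n + a))

/-- `θ₂(z; τ)` -/
def theta2 : ℂ → UpperHalfPlane → ℂ := thetaChar (1 / 2) 0

/-- `θ₃(z; τ)` -/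
def theta3 : ℂ → UpperHalfPlane → ℂ := thetaChar 0 0

/-- `θ₄(z; τ)` -/
def theta4 : ℂ → UpperHalfPlane → ℂ := thetaChar 0 (1 / 2)

/-- The elliptic genus `2φ_{0,1}` of a K3 surface. -/
def ellipticGenusK3 (z : ℂ) (τ : UpperHalfPlane) : ℂ :=
  8 * (theta2 z τ ^ 2 / theta2 0 τ ^ 2 + theta3 z τ ^ 2 / theta3 0 τ ^ 2 +
    theta4 z τ ^ 2 / theta4 0 τ ^ 2)

end

/-! A parity root forces a constant phase on the elliptic genus, and the K3 genus violates it. If `σ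
= e^{iπh(0)}`, all vectors of charge `r + m` have the parity of `r`, so the coefficients of
`ζ^{r+m}` in the supertrace are `(-1)^r` times dimensions (`ramondSuperdim_eq`). At `z = 1/2 + iy`
the sign is absorbed by `ζ^r`. For `τ = it` and real `m`, every term is then a nonnegative real
multiple of `e^{πim} q^{m/4 - c/24}`, a constant that does not depend on `y`
(`nonneg_of_isParityRoot`).

For the K3 genus take `y = 0` and `y = t/2`, that is `z = 1/2` and `z = (1 + τ)/2`. With theta
constants at `z = 0`, the values are `8(θ₄²/θ₃² + θ₃²/θ₄²)` and `8q^{-1/4}(θ₂²/θ₄² - θ₄²/θ₂²)`. The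
first is positive. The second is negative for large `t`, since `θ₂ → 0` and `θ₄ → 1`. Opposite signs
contradict the constant phase, and this is insensitive to an overall sign of the genus.

The level is a priori complex. Comparing the period 1 of the K3 genus with the multiplier `e^{2πim}`
of any elliptic genus (`apply_add_one`) shows that it is an integer, hence real. -/

namespace Module.End

/-- Otherwise the eigenspaces for values other than `a` would already span `M`, and independence of
eigenspaces would make the one for `a` trivial. This confines charges and energies to a lattice. -/
theorem exists_eq_of_isInternal_eigenspace {M ι : Type*} [AddCommGroup M] [Module ℂ M]
    [DecidableEq ι]
    (T : Module.End ℂ M) (f : ι → ℂ) (hT : DirectSum.IsInternal fun i => T.eigenspace (f i))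
    {a : ℂ} {v : M} (hv : v ∈ T.eigenspace a) (hv0 : v ≠ 0) : ∃ i, f i = a := by
  by_contra! hne
  have hdisj := T.eigenspaces_iSupIndep a
  have htop : ⨆ b, ⨆ _ : b ≠ a, T.eigenspace b = ⊤ := by
    rw [eq_top_iff, ← hT.submodule_iSup_eq_top]
    exact iSup_le fun i => le_iSup₂_of_le (f i) (hne i) le_rfl
  rw [htop, disjoint_top] at hdisj
  exact hv0 (by rwa [hdisj, Submodule.mem_bot] at hv)

end Module.End

theorem eq_zero_of_eq_neg_of_complex {M : Type*} [AddCommGroup M] [Module ℂ M] {v : M}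
    (hv : v = -v) : v = 0 := by
  have h2 : (2 : ℂ) • v = 0 := by rw [two_smul, ← eq_neg_iff_add_eq_zero]; exact hv
  exact (smul_eq_zero.1 h2).resolve_left two_ne_zero

/-! ### Charges, energies and parity in the Ramond sector -/

namespace SVOA

variable {V : Type u} [AddCommGroup V] [Module ℂ V] (S : SVOA V)

theorem parityInvolution_of_mem_evenPart {v : V} (hv : v ∈ S.evenPart) :
    S.parityInvolution v = v := by
  have hle : S.evenPart ≤ LinearMap.eqLocus S.parityInvolution LinearMap.id := by
    refine iSup_le fun k w hw => ?_
    rw [LinearMap.mem_eqLocus, parityInvolution, scalarOnPieces_apply _ _ _ _ _ hw]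
    simp [zpow_mul]
  exact hle hv

theorem parityInvolution_of_mem_oddPart {v : V} (hv : v ∈ S.oddPart) :
    S.parityInvolution v = -v := by
  have hle : S.oddPart ≤ LinearMap.eqLocus S.parityInvolution (-LinearMap.id) := by
    refine iSup_le fun k w hw => ?_
    rw [LinearMap.mem_eqLocus, parityInvolution, scalarOnPieces_apply _ _ _ _ _ hw]
    simp [zpow_mul, zpow_add₀]
  exact hle hv

variable {S} in
theorem IsRoot.expPiI_of_mem_eigenspace {h : V} {m : ℂ} (hr : S.IsRoot h m) {r : ℤ} {v : V}
    (hv : v ∈ (S.mode h 0).eigenspace (r : ℂ)) : hr.expPiI v = (-1 : ℂ) ^ r • v := by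
  rw [IsRoot.expPiI, scalarOnPieces_apply _ _ _ _ _ hv, mul_comm _ (r : ℂ), Complex.exp_int_mul,
    Complex.exp_pi_mul_I]

theorem mem_eigenspace_ramondCharge {h v : V} {m a : ℂ} :
    v ∈ (S.ramondCharge h m).eigenspace a ↔ v ∈ (S.mode h 0).eigenspace (a - m) := by
  simp [ramondCharge, sub_smul, eq_sub_iff_add_eq]

theorem mem_eigenspace_ramondEnergy {h v : V} {m a b : ℂ}
    (hv : v ∈ (S.mode h 0).eigenspace a) :
    v ∈ (S.ramondEnergy h m).eigenspace b ↔
      v ∈ (S.L 0).eigenspace (b - a / 2 - m / 4) := by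
  rw [Module.End.mem_eigenspace_iff] at hv
  simp only [Module.End.mem_eigenspace_iff, ramondEnergy, LinearMap.add_apply,
    LinearMap.smul_apply, hv, Module.End.one_apply, sub_smul, smul_smul, eq_sub_iff_add_eq]
  rw [show (1 / 2 : ℂ) * a = a / 2 by ring, add_right_comm]

variable {S} in
/-- The charges and energies of nonzero vectors in the Ramond sector. -/
theorem IsRoot.exists_charge_energy {h : V} {m : ℂ} (hr : S.IsRoot h m) {a b : ℂ} {v : V}
    (hv0 : v ≠ 0) (ha : v ∈ (S.ramondCharge h m).eigenspace a)
    (hb : v ∈ (S.ramondEnergy h m).eigenspace b) :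
    ∃ r k : ℤ, a = r + m ∧ b = k / 2 + r / 2 + m / 4 := by
  rw [mem_eigenspace_ramondCharge] at ha
  rw [mem_eigenspace_ramondEnergy S ha] at hb
  obtain ⟨r, hr'⟩ := Module.End.exists_eq_of_isInternal_eigenspace _ _ hr.semisimple ha hv0
  obtain ⟨k, hk⟩ := Module.End.exists_eq_of_isInternal_eigenspace _ _
    S.isInternal_weightSpace hb hv0
  refine ⟨r, k, by rw [hr']; ring, ?_⟩
  rw [hk, hr']
  ring

variable {S} in
/-- The support of the Ramond superdimension. -/
theorem IsRoot.exists_of_ramondSuperdim_ne_zero {h : V} {m : ℂ} (hr : S.IsRoot h m) {a b : ℂ}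
    (hne : S.ramondSuperdim h m a b ≠ 0) :
    ∃ r k : ℤ, a = r + m ∧ b = k / 2 + r / 2 + m / 4 := by
  by_contra hcon
  have hbot : ∀ P : Submodule ℂ V,
      P ⊓ (S.ramondCharge h m).eigenspace a ⊓ (S.ramondEnergy h m).eigenspace b = ⊥ := by
    refine fun P => (Submodule.eq_bot_iff _).2 fun v hv => ?_
    by_contra hv0
    exact hcon (hr.exists_charge_energy hv0 hv.1.2 hv.2)
  exact hne (by rw [ramondSuperdim, hbot, hbot, sub_self])

variable {S} in
/-- For a parity root, the sign of the superdimension is determined by the charge. -/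
theorem IsRoot.IsParityRoot.ramondSuperdim_eq {h : V} {m : ℂ} {hr : S.IsRoot h m}
    (hp : hr.IsParityRoot) (r : ℤ) (b : ℂ) :
    ∃ N : ℕ, S.ramondSuperdim h m (r + m) b = (-1 : ℂ) ^ r * N := by
  -- Since `σ` is `e^{iπh(0)}`, it is the scalar `(-1)^r` on this charge space; vectors of the
  -- opposite parity there satisfy `v = -v`.
  have hσ : ∀ v ∈ (S.ramondCharge h m).eigenspace (r + m),
      S.parityInvolution v = (-1 : ℂ) ^ r • v := by
    intro v hv
    rw [mem_eigenspace_ramondCharge, add_sub_cancel_right] at hv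
    rw [hp]
    exact hr.expPiI_of_mem_eigenspace hv
  rcases Int.even_or_odd r with he | ho
  · have hbot : S.oddPart ⊓ (S.ramondCharge h m).eigenspace (r + m) ⊓
        (S.ramondEnergy h m).eigenspace b = ⊥ := by
      refine (Submodule.eq_bot_iff _).2 fun v hv => ?_
      have h1 := hσ v hv.1.2
      rw [S.parityInvolution_of_mem_oddPart hv.1.1, he.neg_one_zpow, one_smul] at h1
      exact eq_zero_of_eq_neg_of_complex h1.symm
    exact ⟨Module.finrank ℂ ↥(S.evenPart ⊓ (S.ramondCharge h m).eigenspace (r + m) ⊓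
      (S.ramondEnergy h m).eigenspace b), by
      rw [ramondSuperdim, hbot, finrank_bot, he.neg_one_zpow, Nat.cast_zero, sub_zero, one_mul]⟩
  · have hbot : S.evenPart ⊓ (S.ramondCharge h m).eigenspace (r + m) ⊓
        (S.ramondEnergy h m).eigenspace b = ⊥ := by
      refine (Submodule.eq_bot_iff _).2 fun v hv => ?_
      have h1 := hσ v hv.1.2
      rw [S.parityInvolution_of_mem_evenPart hv.1.1, ho.neg_one_zpow, neg_one_smul] at h1
      exact eq_zero_of_eq_neg_of_complex h1
    exact ⟨Module.finrank ℂ ↥(S.oddPart ⊓ (S.ramondCharge h m).eigenspace (r + m) ⊓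
      (S.ramondEnergy h m).eigenspace b), by
      rw [ramondSuperdim, hbot, finrank_bot, ho.neg_one_zpow, Nat.cast_zero, zero_sub, neg_one_mul]⟩

open Complex in
variable {S} in
/-- The elliptic genus is multiplied by `e^{2πim}` under `z ↦ z + 1`. -/
theorem HasEllipticGenus.apply_add_one {h : V} {m : ℂ} {φ : ℂ → UpperHalfPlane → ℂ}
    (hφ : S.HasEllipticGenus h m φ) (hr : S.IsRoot h m) (z : ℂ) (τ : UpperHalfPlane) :
    φ (z + 1) τ = exp (2 * Real.pi * I * m) * φ z τ := by
  refine (hφ (z + 1) τ).unique (((hφ z τ).mul_left (exp (2 * Real.pi * I * m))).congr_fun ?_)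
  rintro ⟨a, b⟩
  -- The sum ranges over all of `ℂ × ℂ`, but only charges in `m + ℤ` contribute, and on these the
  -- integer part is invisible to `z ↦ z + 1`.
  by_cases hne : S.ramondSuperdim h m a b = 0
  · simp [hne]
  obtain ⟨r, k, rfl, rfl⟩ := hr.exists_of_ramondSuperdim_ne_zero hne
  have hper : exp (2 * Real.pi * I * (z + 1) * (r + m)) =
      exp (2 * Real.pi * I * m) * exp (2 * Real.pi * I * z * (r + m)) := by
    rw [← exp_add, exp_eq_exp_iff_exists_int]
    exact ⟨r, by ring⟩
  simp only [hper]
  ring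

open Complex ComplexOrder in
variable {S} in
/-- On the line `z = 1/2 + iy` the elliptic genus of a parity root of real level has constant
phase. -/
theorem HasEllipticGenus.nonneg_of_isParityRoot {h : V} {m : ℝ} {φ : ℂ → UpperHalfPlane → ℂ}
    (hφ : S.HasEllipticGenus h m φ) {hr : S.IsRoot h m} (hp : hr.IsParityRoot) (y t : ℝ)
    (τ : UpperHalfPlane) (hτ : (τ : ℂ) = t * I) :
    0 ≤ exp (-(Real.pi * I * m + 2 * Real.pi * I * τ * (m / 4 - S.c / 24))) *
      φ (1 / 2 + y * I) τ := by
  refine ((hφ (1 / 2 + y * I) τ).mul_left _).nonneg ?_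
  rintro ⟨a, b⟩
  by_cases hne : S.ramondSuperdim h m a b = 0
  · simp [hne]
  obtain ⟨r, k, rfl, rfl⟩ := hr.exists_of_ramondSuperdim_ne_zero hne
  obtain ⟨N, hN⟩ := hp.ramondSuperdim_eq r (k / 2 + r / 2 + m / 4)
  -- This choice of logarithm cancels the factor `e^{πir}` coming from the real part `1/2` of `z`.
  have hsign : (-1 : ℂ) ^ r = exp (-(Real.pi * I * r)) := by
    rw [show -(Real.pi * I * r) = r * (-(Real.pi * I)) by ring, exp_int_mul, exp_neg, exp_pi_mul_I]
    norm_num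
  -- The prefactor removes `e^{πim}` and the possibly non-real `q^{m/4 - c/24}`. The remaining
  -- exponent is real because `m`, `y` and `t` are.
  have hterm : exp (-(Real.pi * I * m + 2 * Real.pi * I * τ * (m / 4 - S.c / 24))) *
      (exp (-(Real.pi * I * r)) * N *
        exp (2 * Real.pi * I * (1 / 2 + y * I) * (r + m)) *
        exp (2 * Real.pi * I * τ * (k / 2 + r / 2 + m / 4 - S.c / 24))) =
      ((N * Real.exp (-(2 * Real.pi * y * (r + m) + Real.pi * t * (k + r))) : ℝ) : ℂ) := by
    rw [ofReal_mul, ofReal_exp, ofReal_natCast]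
    rw [show ∀ A B C D : ℂ, A * (B * N * C * D) = N * (A * B * C * D) by intros; ring,
      ← exp_add, ← exp_add, ← exp_add, hτ]
    congr 2
    push_cast
    linear_combination (2 * (Real.pi : ℂ) * y * (r + m) + Real.pi * t * (k + r)) * I_sq
  simp only [hN, hsign]
  rw [hterm]
  exact_mod_cast by positivity

end SVOA

/-! ### Values of the theta series at half-periods -/

section ThetaValues

open Complex

/-- Reindexing by `n ↦ -1 - n` shows that the sum equals its own negative; no summability is needed.
It yields the zeros of `θ₂` and `θ₃`. -/
theorem tsum_int_eq_zero_of_reflect (f : ℤ → ℂ) (hf : ∀ n, f (-1 - n) = -f n) :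
    ∑' n, f n = 0 := by
  have h1 := (Equiv.subLeft (-1 : ℤ)).tsum_eq f
  simp only [Equiv.subLeft_apply, hf, tsum_neg] at h1
  exact self_eq_neg.1 h1.symm

/-- Only the square of `θ₂` is periodic: its exponents lie in `ℤ + 1/2`, so `θ₂` itself changes
sign. -/
theorem theta_add_one_sq (z : ℂ) (τ : UpperHalfPlane) :
    theta2 (z + 1) τ ^ 2 = theta2 z τ ^ 2 ∧ theta3 (z + 1) τ = theta3 z τ ∧
      theta4 (z + 1) τ = theta4 z τ := by
  have key : ∀ a b : ℝ, thetaChar a b (z + 1) τ = exp (2 * Real.pi * I * a) * thetaChar a b z τ := by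
    intro a b
    rw [thetaChar, thetaChar, ← tsum_mul_left]
    refine tsum_congr fun n => ?_
    simp only [← exp_add]
    rw [exp_eq_exp_iff_exists_int]
    exact ⟨n, by ring⟩
  refine ⟨?_, ?_, ?_⟩
  · rw [theta2, key, mul_pow, ← exp_nat_mul]
    have : ((2 : ℕ) : ℂ) * (2 * Real.pi * I * ((1 / 2 : ℝ) : ℂ)) = 2 * Real.pi * I := by
      push_cast; ring
    rw [this, exp_two_pi_mul_I, one_mul]
  · rw [theta3, key]; simp
  · rw [theta4, key]; simp

theorem ellipticGenusK3_add_one (z : ℂ) (τ : UpperHalfPlane) :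
    ellipticGenusK3 (z + 1) τ = ellipticGenusK3 z τ := by
  obtain ⟨h2, h3, h4⟩ := theta_add_one_sq z τ
  rw [ellipticGenusK3, ellipticGenusK3, h2, h3, h4]

theorem exp_add_intCast_mul_pi_mul_I (x : ℂ) (n : ℤ) :
    exp (x + (2 * n + 1) * (Real.pi * I)) = -exp x := by
  rw [show x + (2 * n + 1) * (Real.pi * I) = x + Real.pi * I + n * (2 * Real.pi * I) by ring,
    exp_periodic.int_mul n, exp_add, exp_pi_mul_I, mul_neg_one]

theorem theta2_half (τ : UpperHalfPlane) : theta2 (1 / 2) τ = 0 := by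
  refine tsum_int_eq_zero_of_reflect _ fun n => ?_
  simp only [← exp_add]
  -- The reflection negates `n + 1/2`: the `q`-power is unchanged and `e^{πi(n+1/2)}` is multiplied
  -- by `e^{-πi(2n+1)} = -1`.
  rw [← exp_add_intCast_mul_pi_mul_I _ (-n - 1)]
  congr 1
  push_cast
  ring

theorem theta3_half (τ : UpperHalfPlane) : theta3 (1 / 2) τ = theta4 0 τ := by
  refine tsum_congr fun n => ?_
  simp only [← exp_add]
  congr 1
  push_cast
  ring

theorem theta4_half (τ : UpperHalfPlane) : theta4 (1 / 2) τ = theta3 0 τ := by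
  refine tsum_congr fun n => ?_
  simp only [← exp_add]
  rw [exp_eq_exp_iff_exists_int]
  refine ⟨n, ?_⟩
  push_cast
  ring

/-- The terms are `(-1)^n q^{n(n+1)/2}`; the reflection fixes `n(n+1)` and flips the sign. -/
theorem theta3_half_period (τ : UpperHalfPlane) : theta3 (1 / 2 + τ / 2) τ = 0 := by
  refine tsum_int_eq_zero_of_reflect _ fun n => ?_
  simp only [← exp_add]
  rw [← exp_add_intCast_mul_pi_mul_I _ (-n - 1)]
  congr 1
  push_cast
  ring

/-- The signs from the characteristic and from `z` cancel; then complete the square, `n² + n = (n +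
1/2)² - 1/4`. -/
theorem theta4_half_period (τ : UpperHalfPlane) :
    theta4 (1 / 2 + τ / 2) τ = exp (-(Real.pi * I * τ / 4)) * theta2 0 τ := by
  rw [theta4, theta2, thetaChar, thetaChar, ← tsum_mul_left]
  refine tsum_congr fun n => ?_
  simp only [← exp_add]
  rw [exp_eq_exp_iff_exists_int]
  refine ⟨n, ?_⟩
  push_cast
  ring

/-- Here `(n + 1/2)² + (n + 1/2) = (n + 1)² - 1/4` and `e^{πi(n+1/2)} = -i(-1)^{n+1}`, whence the
index shift by one and the factor `-I`. -/
theorem theta2_half_period (τ : UpperHalfPlane) :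
    theta2 (1 / 2 + τ / 2) τ = -I * exp (-(Real.pi * I * τ / 4)) * theta4 0 τ := by
  rw [theta4, theta2, thetaChar, thetaChar, ← tsum_mul_left, ← (Equiv.addRight (1 : ℤ)).tsum_eq
    (fun n : ℤ => -I * exp (-(Real.pi * I * τ / 4)) * _)]
  refine tsum_congr fun n => ?_
  have hI : -I = exp (-(Real.pi / 2 * I)) := by
    rw [exp_neg, exp_pi_div_two_mul_I, inv_I]
  simp only [hI, ← exp_add]
  congr 1
  push_cast [Equiv.coe_addRight]
  ring

theorem ellipticGenusK3_half (τ : UpperHalfPlane) :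
    ellipticGenusK3 (1 / 2) τ =
      8 * (theta4 0 τ ^ 2 / theta3 0 τ ^ 2 + theta3 0 τ ^ 2 / theta4 0 τ ^ 2) := by
  rw [ellipticGenusK3, theta2_half, theta3_half, theta4_half]
  ring

theorem ellipticGenusK3_half_period (τ : UpperHalfPlane) :
    ellipticGenusK3 (1 / 2 + τ / 2) τ =
      8 * exp (-(Real.pi * I * τ / 4)) ^ 2 *
        (theta2 0 τ ^ 2 / theta4 0 τ ^ 2 - theta4 0 τ ^ 2 / theta2 0 τ ^ 2) := by
  rw [ellipticGenusK3, theta2_half_period, theta3_half_period, theta4_half_period, mul_pow, mul_pow,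
    neg_sq, I_sq]
  ring

end ThetaValues

/-! ### Theta constants on the imaginary axis -/

section ThetaConstants

open Filter Topology

theorem summable_exp_neg_mul_int_add_sq (a : ℝ) {t : ℝ} (ht : 0 < t) :
    Summable fun n : ℤ => Real.exp (-(Real.pi * t * ((n : ℝ) + a) ^ 2)) := by
  refine (HurwitzKernelBounds.summable_f_int 0 a ht).congr fun n => ?_
  rw [HurwitzKernelBounds.f_int, pow_zero, one_mul]
  congr 1
  ring

theorem summable_exp_neg_mul_int_sq {t : ℝ} (ht : 0 < t) :
    Summable fun n : ℤ => Real.exp (-(Real.pi * t * (n : ℝ) ^ 2)) := by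
  simpa using summable_exp_neg_mul_int_add_sq 0 ht

theorem tendsto_exp_neg_mul_atTop {x : ℝ} (hx : 0 < x) :
    Tendsto (fun t : ℝ => Real.exp (-(Real.pi * t * x))) atTop (𝓝 0) := by
  refine Real.tendsto_exp_neg_atTop_nhds_zero.comp ?_
  exact (tendsto_id.const_mul_atTop Real.pi_pos).atTop_mul_const hx

/-- Dominated convergence with the series at `t = 1` as bound; `n + 1/2` never vanishes, so every
term decays. -/
theorem tendsto_tsum_exp_neg_mul_int_add_half_sq :
    Tendsto (fun t : ℝ => ∑' n : ℤ, Real.exp (-(Real.pi * t * ((n : ℝ) + 1 / 2) ^ 2))) atTop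
      (𝓝 0) := by
  rw [← tsum_zero (β := ℤ) (α := ℝ)]
  refine tendsto_tsum_of_dominated_convergence
    (summable_exp_neg_mul_int_add_sq (1 / 2) one_pos) (fun n => ?_) ?_
  · have hn : (n : ℝ) + 1 / 2 ≠ 0 := by
      intro h0
      have h1 : ((2 * n + 1 : ℤ) : ℝ) = 0 := by push_cast; linarith
      have := Int.cast_eq_zero.1 h1
      omega
    exact tendsto_exp_neg_mul_atTop (by positivity)
  · filter_upwards [eventually_ge_atTop 1] with t ht n
    rw [Real.norm_eq_abs, Real.abs_exp]
    gcongr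

theorem tendsto_tsum_neg_one_zpow_mul_exp_neg_mul_int_sq :
    Tendsto (fun t : ℝ => ∑' n : ℤ, (-1 : ℝ) ^ n * Real.exp (-(Real.pi * t * (n : ℝ) ^ 2))) atTop
      (𝓝 1) := by
  -- The limit `1` is rewritten as the sum of the termwise limits, of which only `n = 0` survives.
  have hsum : ∑' n : ℤ, (if n = 0 then 1 else 0) = (1 : ℝ) := tsum_ite_eq 0 _
  nth_rewrite 2 [← hsum]
  refine tendsto_tsum_of_dominated_convergence
    (summable_exp_neg_mul_int_sq one_pos) (fun n => ?_) ?_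
  · split_ifs with hn
    · simp [hn]
    · simpa using (tendsto_exp_neg_mul_atTop (x := (n : ℝ) ^ 2) (by positivity)).const_mul
        ((-1 : ℝ) ^ n)
  · filter_upwards [eventually_ge_atTop 1] with t ht n
    rw [norm_mul, norm_zpow, norm_neg, norm_one, one_zpow, one_mul, Real.norm_eq_abs, Real.abs_exp]
    gcongr

theorem theta2_zero_eq_ofReal {τ : UpperHalfPlane} {t : ℝ} (hτ : (τ : ℂ) = t * Complex.I) :
    theta2 0 τ = ((∑' n : ℤ, Real.exp (-(Real.pi * t * ((n : ℝ) + 1 / 2) ^ 2)) : ℝ) : ℂ) := by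
  rw [theta2, thetaChar, Complex.ofReal_tsum]
  refine tsum_congr fun n => ?_
  rw [hτ, ← Complex.exp_add, ← Complex.exp_add, Complex.ofReal_exp]
  congr 1
  push_cast
  linear_combination (Real.pi * t * (n + 1 / 2) ^ 2 : ℂ) * Complex.I_sq

theorem theta3_zero_eq_ofReal {τ : UpperHalfPlane} {t : ℝ} (hτ : (τ : ℂ) = t * Complex.I) :
    theta3 0 τ = ((∑' n : ℤ, Real.exp (-(Real.pi * t * (n : ℝ) ^ 2)) : ℝ) : ℂ) := by
  rw [theta3, thetaChar, Complex.ofReal_tsum]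
  refine tsum_congr fun n => ?_
  rw [hτ, ← Complex.exp_add, ← Complex.exp_add, Complex.ofReal_exp]
  congr 1
  push_cast
  linear_combination (Real.pi * t * n ^ 2 : ℂ) * Complex.I_sq

theorem theta4_zero_eq_ofReal {τ : UpperHalfPlane} {t : ℝ} (hτ : (τ : ℂ) = t * Complex.I) :
    theta4 0 τ =
      ((∑' n : ℤ, (-1 : ℝ) ^ n * Real.exp (-(Real.pi * t * (n : ℝ) ^ 2)) : ℝ) : ℂ) := by
  rw [theta4, thetaChar, Complex.ofReal_tsum]
  refine tsum_congr fun n => ?_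
  have hsign : (-1 : ℂ) ^ n = Complex.exp (n * (Real.pi * Complex.I)) := by
    rw [Complex.exp_int_mul, Complex.exp_pi_mul_I]
  push_cast
  rw [hsign, hτ, ← Complex.exp_add, ← Complex.exp_add, ← Complex.exp_add]
  congr 1
  linear_combination (Real.pi * t * n ^ 2 : ℂ) * Complex.I_sq

/-- High on the imaginary axis the theta constants are positive, and `θ₂(0) < θ₄(0)`. -/
theorem exists_theta2_zero_lt_theta4_zero :
    ∃ (t : ℝ) (τ : UpperHalfPlane) (A C D : ℝ), (τ : ℂ) = t * Complex.I ∧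
      theta2 0 τ = A ∧ theta3 0 τ = C ∧ theta4 0 τ = D ∧ 0 < A ∧ 0 < C ∧ A < D := by
  obtain ⟨t, hAD, ht⟩ := ((tendsto_tsum_exp_neg_mul_int_add_half_sq.eventually_lt
    tendsto_tsum_neg_one_zpow_mul_exp_neg_mul_int_sq one_pos).and (eventually_gt_atTop 0)).exists
  have hτ : ((⟨t * Complex.I, by simpa using ht⟩ : UpperHalfPlane) : ℂ) = t * Complex.I := rfl
  refine ⟨t, _, _, _, _, hτ, theta2_zero_eq_ofReal hτ, theta3_zero_eq_ofReal hτ,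
    theta4_zero_eq_ofReal hτ, ?_, ?_, hAD⟩
  · exact (summable_exp_neg_mul_int_add_sq (1 / 2) ht).tsum_pos (fun _ => (Real.exp_pos _).le) 0
      (Real.exp_pos _)
  · exact (summable_exp_neg_mul_int_sq ht).tsum_pos (fun _ => (Real.exp_pos _).le) 0
      (Real.exp_pos _)

end ThetaConstants

/-! ### The sign change of the K3 elliptic genus -/

open Complex ComplexOrder in
/-- Neither sign of the K3 elliptic genus is the elliptic genus of a parity root. -/
theorem SVOA.IsRoot.IsParityRoot.not_hasEllipticGenus {V : Type u} [AddCommGroup V] [Module ℂ V]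
    {S : SVOA V} {h : V} {m : ℂ} {hr : S.IsRoot h m} (hp : hr.IsParityRoot) {s : ℝ} (hs : s ≠ 0) :
    ¬ S.HasEllipticGenus h m fun z τ => s * ellipticGenusK3 z τ := by
  intro hφ
  obtain ⟨t, τ, A, C, D, hτ, hA, hC, hD, hA0, hC0, hAD⟩ := exists_theta2_zero_lt_theta4_zero
  have hD0 : 0 < D := hA0.trans hAD
  set P : ℝ := 8 * (D ^ 2 / C ^ 2 + C ^ 2 / D ^ 2) with hPdef
  have hP : ellipticGenusK3 (1 / 2) τ = (P : ℂ) := by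
    rw [ellipticGenusK3_half, hC, hD, hPdef]; push_cast; rfl
  have hP0 : 0 < P := by positivity
  -- The squared exponential is `q^{-1/4}` at `τ = it`, so the sign of `Q` is decided by `A < D`.
  set Q : ℝ := 8 * Real.exp (Real.pi * t / 4) ^ 2 * (A ^ 2 / D ^ 2 - D ^ 2 / A ^ 2) with hQdef
  have hQ : ellipticGenusK3 (1 / 2 + (t / 2 : ℝ) * I) τ = (Q : ℂ) := by
    rw [show (1 / 2 + (t / 2 : ℝ) * I : ℂ) = 1 / 2 + τ / 2 by rw [hτ]; push_cast; ring,
      ellipticGenusK3_half_period, hA, hD, hQdef, hτ]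
    push_cast
    congr 4
    linear_combination (-(Real.pi * t / 4) : ℂ) * I_sq
  have hQ0 : Q < 0 := by
    have hlt : A ^ 2 < D ^ 2 := by gcongr
    have h1 : A ^ 2 / D ^ 2 < 1 := (div_lt_one (by positivity)).2 hlt
    have h2 : 1 < D ^ 2 / A ^ 2 := (one_lt_div (by positivity)).2 hlt
    exact mul_neg_of_pos_of_neg (by positivity) (by linarith)
  -- The genus has period 1 in `z` and does not vanish at `z = 1/2`, so `e^{2πim} = 1`.
  obtain ⟨n, hn⟩ : ∃ n : ℤ, m = n := by
    have h1 := hφ.apply_add_one hr (1 / 2) τ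
    simp only [ellipticGenusK3_add_one, hP] at h1
    have hne : (s * P : ℂ) ≠ 0 := by exact_mod_cast mul_ne_zero hs hP0.ne'
    obtain ⟨n, hn⟩ := exp_eq_one_iff.1 (mul_right_cancel₀ hne (h1.symm.trans (one_mul _).symm))
    refine ⟨n, mul_left_cancel₀ two_pi_I_ne_zero ?_⟩
    rw [hn, mul_comm]
  obtain ⟨m', rfl⟩ : ∃ m' : ℝ, m = (m' : ℂ) := ⟨n, by rw [hn]; push_cast; rfl⟩
  have h1 := hφ.nonneg_of_isParityRoot hp 0 t τ hτ
  have h2 := hφ.nonneg_of_isParityRoot hp (t / 2) t τ hτ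
  simp only [ofReal_zero, zero_mul, add_zero] at h1
  rw [hP] at h1
  rw [hQ] at h2
  set K := exp (-(Real.pi * I * m' + 2 * Real.pi * I * τ * (m' / 4 - S.c / 24))) with hK
  have hK0 : K ≠ 0 := exp_ne_zero _
  -- Both `K * (s * P)` and `K * (s * Q)` are nonnegative reals. Scaling the second by `P / -Q > 0`
  -- gives `-(K * (s * P)) ≥ 0`, without knowing the phase of `K` or the sign of `s`.
  have h3 : K * (s * P) = 0 := by
    refine le_antisymm ?_ h1
    have h4 := mul_nonneg (show (0 : ℂ) ≤ ((P / -Q : ℝ) : ℂ) by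
      exact_mod_cast (div_pos hP0 (neg_pos.2 hQ0)).le) h2
    have hQc : (Q : ℂ) ≠ 0 := by exact_mod_cast hQ0.ne
    rw [← neg_nonneg]
    convert h4 using 1
    push_cast
    field_simp
  have hne : (s * P : ℂ) ≠ 0 := by exact_mod_cast mul_ne_zero hs hP0.ne'
  exact mul_ne_zero hK0 hne h3

theorem mainTheorem4 :
    (∀ (V : Type u) [AddCommGroup V] [Module ℂ V] (S : SVOA V) (h : V) (m : ℂ)
        (hr : S.IsRoot h m),
      (S.HasEllipticGenus h m ellipticGenusK3 ∨
        S.HasEllipticGenus h m fun z τ => -ellipticGenusK3 z τ) →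
      ¬ hr.IsParityRoot) ∧
    ¬ ∃ (V : Type u) (_ : AddCommGroup V) (_ : Module ℂ V) (S : SVOA V) (h : V) (m : ℂ)
        (hr : S.IsRoot h m),
      hr.IsParityRoot ∧ S.HasEllipticGenus h m ellipticGenusK3 := by
  have key : ∀ (V : Type u) [AddCommGroup V] [Module ℂ V] (S : SVOA V) (h : V) (m : ℂ)
        (hr : S.IsRoot h m),
      (S.HasEllipticGenus h m ellipticGenusK3 ∨
        S.HasEllipticGenus h m fun z τ => -ellipticGenusK3 z τ) →
      ¬ hr.IsParityRoot := by
    rintro V _ _ S h m hr (hφ | hφ) hp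
    · exact hp.not_hasEllipticGenus one_ne_zero (by simpa using hφ)
    · exact hp.not_hasEllipticGenus (s := -1) (by norm_num) (by simpa using hφ)
  refine ⟨key, ?_⟩
  rintro ⟨V, _, _, S, h, m, hr, hp, hφ⟩
  exact key V S h m hr (Or.inl hφ) hp
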